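/- Let $P=((j_1,c_1),\dots,(j_L,c_L))$, with $j_q\in\{1,\dots,N\}$ and $c_q\in\mathbb R$, be a product formula: for bounded self-adjoint operators $h_1,\dots,h_N$ on a complex Hilbert space and $\Delta\in\mathbb R$ put $U_\alpha(\Delta)=e^{-ic_1\Delta h_{j_1}}e^{-ic_2\Delta h_{j_2}}\cdots e^{-ic_L\Delta h_{j_L}}$ and $H=\sum_{j=1}^N h_j$. Then there are real numbers $\kappa_k(w)$, one for each integer $k\ge1$ and each finite word $w=(w_1,\dots,w_\beta)$ in $\{1,\dots,N\}$, that depend only on $P$ (not on the Hilbert space, the operators $h_j$, the step $\Delta$, or the parameters $\alpha,m,M,\vec a,\vec k$ below), with the following property. With these coefficients, define the linear combination of nested commutators of depth $\beta$ $$C^{(k)}_\beta=\sum_{w\in\{1,\dots,N\}^\beta}\kappa_k(w)\,[h_{w_1},[h_{w_2},[\cdots,[h_{w_{\beta-1}},h_{w_\beta}]\cdots]]]$$ (for $\beta=1$ the nested commutator of $w$ is $h_{w_1}$). Suppose that $U_\alpha$ is correct to order $\alpha$ for $H$, i.e. $U_\alpha(\Delta)=e^{-i\Delta H}+\mathcal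 O(\Delta^{\alpha+1})$ as $\Delta\to0$, and that, for real $a_1,\dots,a_M$ and positive integers $k_1,\dots,k_M$, the multiproduct formula $U_{\vec k}(\Delta)=\sum_{j=1}^M a_j\,U_\alpha(\Delta/k_j)^{k_j}$ has order $2m$, i.e. $U_{\vec k}(\Delta)=e^{-i\Delta H}+\mathcal O(\Delta^{2m+1})$. Then for every $\Delta\in\mathbb R$ the error depends on the Hamiltonian terms only through nested commutators of depth $\beta>\alpha$: $$U_{\vec k}(\Delta)e^{i\Delta H}-I=\sum_{n>2m}(-i\Delta)^n\sum_{l\ge1}\ \sum_{\substack{m_1+\cdots+m_l=n\\ m_1,\dots,m_l>\alpha}}\xi(m_1,\dots,m_l)\sum_{j=1}^M a_j\,C^{(k_j)}_{m_1}C^{(k_j)}_{m_2}\cdots C^{(k_j)}_{m_l},$$ where $\xi(m_1,\dots,m_l)=\prod_{i=1}^l\big(m_i+m_{i+1}+\cdots+m_l\big)^{-1}$ and the series over $n$ converges unconditionally in operator norm. -/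

import Mathlib

open scoped BigOperators Topology

noncomputable section

/-- A product formula for a Hamiltonian with `N` terms: the finite sequence of its stages
`(j, c)`, where the stage `(j, c)` stands for the exponential `exp (-i c Δ h_j)`. -/
abbrev ProductFormula (N : ℕ) := List (Fin N × ℝ)

section Operators

variable {E : Type*} [NormedAddCommGroup E] [InnerProductSpace ℂ E] [CompleteSpace E]

/-- The Hamiltonian `H = ∑ j, h j`. -/
def hamiltonian {N : ℕ} (h : Fin N → (E →L[ℂ] E)) : E →L[ℂ] E := ∑ j, h j

/-- The evolution `exp (-i Δ A)` generated by the bounded operator `A`. -/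
def evolution (A : E →L[ℂ] E) (Δ : ℝ) : E →L[ℂ] E :=
  NormedSpace.exp ((-Complex.I * (Δ : ℂ)) • A)

/-- The operator `U(Δ)` of a product formula: the ordered product, first stage leftmost, of the
exponentials `exp (-i c Δ h_j)`. -/
def ProductFormula.toOp {N : ℕ} (P : ProductFormula N) (h : Fin N → (E →L[ℂ] E)) (Δ : ℝ) :
    E →L[ℂ] E :=
  (P.map fun s => evolution (h s.1) (s.2 * Δ)).prod

/-- The multiproduct formula `U_k(Δ) = ∑ j, a_j U(Δ / k_j) ^ k_j` with base formula `U`. -/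
def multiproduct {N M : ℕ} (P : ProductFormula N) (a : Fin M → ℝ) (k : Fin M → ℕ)
    (h : Fin N → (E →L[ℂ] E)) (Δ : ℝ) : E →L[ℂ] E :=
  ∑ j, (a j : ℂ) • (P.toOp h (Δ / (k j : ℝ))) ^ (k j)

/-- `V` is correct to order `p` for `H`: `V(Δ) = exp (-i Δ H) + O(Δ ^ (p + 1))` as `Δ → 0`. -/
def CorrectToOrder (V : ℝ → (E →L[ℂ] E)) (H : E →L[ℂ] E) (p : ℕ) : Prop :=
  (fun Δ : ℝ => V Δ - evolution H Δ) =O[𝓝 0] fun Δ : ℝ => Δ ^ (p + 1)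

/-- The right-nested commutator `[h_{w_1}, [h_{w_2}, [⋯, [h_{w_{β-1}}, h_{w_β}] ⋯ ]]]` of the word
`w = w_1 ⋯ w_β`; it is `h_{w_1}` for a word of length one (and zero for the empty word). -/
def nestedCommutator {N : ℕ} (h : Fin N → (E →L[ℂ] E)) : List (Fin N) → (E →L[ℂ] E)
  | [] => 0
  | [j] => h j
  | j :: j' :: w => h j * nestedCommutator h (j' :: w) - nestedCommutator h (j' :: w) * h j

/-- The linear combination `∑ w, κ(w) [h_{w_1}, [⋯, [h_{w_{β-1}}, h_{w_β}] ⋯ ]]` of the nested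
commutators of depth `β`, the sum running over all words `w` of length `β`. -/
def commutatorSum {N : ℕ} (h : Fin N → (E →L[ℂ] E)) (κ : (β : ℕ) → (Fin β → Fin N) → ℝ) (β : ℕ) :
    E →L[ℂ] E :=
  ∑ w : Fin β → Fin N, (κ β w : ℂ) • nestedCommutator h (List.ofFn w)

end Operators

/-- The weight `ξ(m_1, …, m_l) = ∏ i, (m_i + m_{i+1} + ⋯ + m_l)⁻¹`. -/
def lamWeight : List ℕ → ℝ
  | [] => 1
  | b :: l => ((b + l.sum : ℕ) : ℝ)⁻¹ * lamWeight l

end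

/-!
The error operators are expanded as formal power series in `z = -i Δ` over the ring of bounded
operators. Let `S` be the list of stages of `U(Δ / k) ^ k`, with formal product
`V = ∏ exp (z c h_j)` (`stageSeries`), and let `W = V exp (-z H)` (`errorSeries`). Write
`θ = z d/dz` (`eulerDeriv`). The generator `C = (θ V - V z H) V⁻¹` satisfies a recursion in the stages:
it is `-z H` for the empty list, and a new stage `(j, c)` on the left turns `C` into
`z c h_j + exp (z c ad h_j) C`. Since `ad h_j` puts the letter `j` in front of a right-nested
commutator and raises the power of `z` by one, the coefficient of `z ^ β` in `C` is a combination of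
nested commutators of depth `β`, with real coefficients that are computed from the stages alone
(`generatorCoeff`); these are the numbers `κ_k(w)`. The identity `θ V = C V + V z H`
(`eulerDeriv_stageSeries`) rests on `exp (ad A) Y * exp A = exp A * Y` (`formalConj_mul_formalExp`).

It follows that `θ W = C W`, so the coefficients of `W` satisfy `n W_n = ∑ p, C_p W_{n - p}`.
Iterating this gives the sum over compositions with the weights `ξ` (`coeff_eq_sum_composition`).

Products of exponentials are absolutely convergent power series (`hasAbsSum_errorSeries`), hence the
coefficients up to order `p` of a series that is `1 + O(Δ ^ (p + 1))` are those of `1`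
(`coeff_eq_ite_of_isBigO_sub_one`). If `U` is correct to order `α`, then so is each `U(Δ / k) ^ k`
(`CorrectToOrder.repeated`); thus `W_1, …, W_α` vanish, and by the recursion so do `C_1, …, C_α`:
only compositions with all blocks larger than `α` survive. The order condition on the multiproduct
formula removes the terms with `n ≤ 2 m` in the same way.
-/

noncomputable section

/-! ### Formal exponentials and conjugation -/

section FormalSeries

open PowerSeries Finset Nat

variable {R : Type*} [Ring R]

/-- The Euler derivation `X d/dX`, which multiplies the coefficient of `X ^ n` by `n`. It is
defined coefficientwise because `R` is not assumed commutative. -/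
def eulerDeriv (f : PowerSeries R) : PowerSeries R := PowerSeries.mk fun n => n • coeff n f

@[simp]
theorem coeff_eulerDeriv (f : PowerSeries R) (n : ℕ) :
    coeff n (eulerDeriv f) = n • coeff n f := by
  simp [eulerDeriv]

theorem eulerDeriv_mul (f g : PowerSeries R) :
    eulerDeriv (f * g) = eulerDeriv f * g + f * eulerDeriv g := by
  ext n
  simp only [coeff_eulerDeriv, coeff_mul, map_add, Finset.smul_sum, ← Finset.sum_add_distrib]
  refine Finset.sum_congr rfl fun p hp => ?_
  rw [← HasAntidiagonal.mem_antidiagonal.1 hp, add_smul, smul_mul_assoc, mul_smul_comm]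

@[simp]
theorem eulerDeriv_one : eulerDeriv (1 : PowerSeries R) = 0 := by
  ext n
  rcases n with _ | n <;> simp [coeff_one]

variable [Algebra ℂ R]

/-- The formal exponential series `∑ n, (A ^ n / n!) X ^ n` of an element `A`. -/
def formalExp (A : R) : PowerSeries R := PowerSeries.mk fun n => ((n ! : ℂ)⁻¹) • A ^ n

@[simp]
theorem coeff_formalExp (A : R) (n : ℕ) : coeff n (formalExp A) = ((n ! : ℂ)⁻¹) • A ^ n := by
  simp [formalExp]

theorem inv_factorial_smul_choose {M : Type*} [AddCommGroup M] [Module ℂ M] {n p q : ℕ}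
    (h : p + q = n) (x : M) :
    ((n ! : ℂ)⁻¹) • (n.choose p • x) = (((p ! : ℂ)⁻¹) * ((q ! : ℂ)⁻¹)) • x := by
  subst h
  rw [← Nat.cast_smul_eq_nsmul ℂ, smul_smul]
  congr 1
  have h1 : (((p + q)! : ℕ) : ℂ) ≠ 0 := by exact_mod_cast (p + q).factorial_ne_zero
  have h2 : ((p ! : ℕ) : ℂ) ≠ 0 := by exact_mod_cast p.factorial_ne_zero
  have h3 : ((q ! : ℕ) : ℂ) ≠ 0 := by exact_mod_cast q.factorial_ne_zero
  have h4 : (((p + q).choose p : ℕ) : ℂ) * p ! * q ! = (p + q)! := by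
    rw [Nat.choose_symm_add]
    exact_mod_cast Nat.add_choose_mul_factorial_mul_factorial p q
  field_simp
  linear_combination h4

theorem formalExp_eulerDeriv (A : R) :
    eulerDeriv (formalExp A) = PowerSeries.X * (PowerSeries.C A * formalExp A) := by
  ext n
  rcases n with _ | n
  · simp
  · rw [coeff_succ_X_mul, coeff_eulerDeriv, coeff_C_mul, coeff_formalExp, coeff_formalExp,
      mul_smul_comm, ← _root_.pow_succ', ← Nat.cast_smul_eq_nsmul ℂ, smul_smul]
    congr 1
    have h1 : ((n ! : ℕ) : ℂ) ≠ 0 := by exact_mod_cast n.factorial_ne_zero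
    have h2 : ((n + 1 : ℕ) : ℂ) ≠ 0 := by exact_mod_cast n.succ_ne_zero
    rw [Nat.factorial_succ]
    push_cast at h2 ⊢
    field_simp

/-- The inner derivation `y ↦ A y - y A`. -/
def innerDer (A : R) : Module.End ℂ R := LinearMap.mulLeft ℂ A - LinearMap.mulRight ℂ A

@[simp]
theorem innerDer_apply (A y : R) : innerDer A y = A * y - y * A := rfl

/-- Left multiplication by `A` is `ad A` plus right multiplication, and these commute. -/
theorem pow_mul_eq_sum_innerDer (A y : R) (n : ℕ) :
    A ^ n * y = ∑ p ∈ antidiagonal n, n.choose p.1 • ((innerDer A ^ p.1) y * A ^ p.2) := by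
  have hc : Commute (innerDer A) (LinearMap.mulRight ℂ A) := by
    ext y
    simp [mul_assoc, sub_mul]
  have h := congrArg (fun f : Module.End ℂ R => f y) (hc.add_pow' n)
  have h1 : innerDer A + LinearMap.mulRight ℂ A = LinearMap.mulLeft ℂ A := by
    simp [innerDer]
  rw [h1] at h
  simp only [LinearMap.pow_mulLeft, LinearMap.mulLeft_apply, LinearMap.sum_apply,
    LinearMap.smul_apply] at h
  rw [h]
  refine Finset.sum_congr rfl fun p _ => ?_
  have := congrArg (fun f : Module.End ℂ R => f y) (hc.pow_pow p.1 p.2)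
  simp only [LinearMap.pow_mulRight, Module.End.mul_apply, LinearMap.mulRight_apply] at this ⊢
  rw [this]

/-- The formal series `exp (X ad A) Y`. -/
def formalConj (A : R) (Y : PowerSeries R) : PowerSeries R :=
  PowerSeries.mk fun n => ∑ p ∈ antidiagonal n, ((p.1 ! : ℂ)⁻¹) • (innerDer A ^ p.1) (coeff p.2 Y)

/-- The formal version of `exp (ad A) Y = exp A * Y * exp (-A)`. -/
theorem formalConj_mul_formalExp (A : R) (Y : PowerSeries R) :
    formalConj A Y * formalExp A = formalExp A * Y := by
  ext n
  simp only [coeff_mul, formalConj, coeff_mk, coeff_formalExp, smul_mul_assoc,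
    pow_mul_eq_sum_innerDer, Finset.smul_sum, Finset.sum_mul, mul_smul_comm]
  rw [Finset.sum_sigma', Finset.sum_sigma']
  -- Both sides are sums over triples of exponents, grouped differently; the regrouping map is an
  -- involution.
  refine Finset.sum_nbij' (fun s => ⟨(s.2.1 + s.1.2, s.2.2), (s.2.1, s.1.2)⟩)
    (fun s => ⟨(s.2.1 + s.1.2, s.2.2), (s.2.1, s.1.2)⟩) ?_ ?_ ?_ ?_ ?_
  · rintro ⟨⟨a, b⟩, ⟨c, d⟩⟩ h
    simp only [mem_sigma, HasAntidiagonal.mem_antidiagonal] at h ⊢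
    exact ⟨by omega, trivial⟩
  · rintro ⟨⟨a, b⟩, ⟨c, d⟩⟩ h
    simp only [mem_sigma, HasAntidiagonal.mem_antidiagonal] at h ⊢
    exact ⟨by omega, trivial⟩
  · rintro ⟨⟨a, b⟩, ⟨c, d⟩⟩ h
    simp only [mem_sigma, HasAntidiagonal.mem_antidiagonal] at h ⊢
    obtain ⟨h1, rfl⟩ := h
    rfl
  · rintro ⟨⟨a, b⟩, ⟨c, d⟩⟩ h
    simp only [mem_sigma, HasAntidiagonal.mem_antidiagonal] at h ⊢
    obtain ⟨h1, rfl⟩ := h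
    rfl
  · rintro ⟨⟨a, b⟩, ⟨c, d⟩⟩ h
    simp only [mem_sigma, HasAntidiagonal.mem_antidiagonal] at h ⊢
    rw [inv_factorial_smul_choose rfl, smul_smul, mul_comm]

end FormalSeries

/-! ### Linear differential equations and compositions -/

section Compositions

/-- Splitting off the first block of a composition. -/
theorem sum_composition_eq_sum_antidiagonal {M : Type*} [AddCommMonoid M] (f : List ℕ → M) {n : ℕ}
    (hn : n ≠ 0) :
    ∑ c : Composition n, f c.blocks =
      ∑ p ∈ Finset.HasAntidiagonal.antidiagonal n with p.1 ≠ 0,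
        ∑ c : Composition p.2, f (p.1 :: c.blocks) := by
  rw [Finset.sum_sigma']
  symm
  refine Finset.sum_bij (fun s hs => ⟨s.1.1 :: s.2.blocks, ?_, ?_⟩) ?_ ?_ ?_ ?_
  · intro i hi
    simp only [Finset.mem_sigma, Finset.mem_filter, Finset.mem_univ, and_true] at hs
    rcases List.mem_cons.1 hi with rfl | hi
    · exact Nat.pos_of_ne_zero hs.2
    · exact s.2.blocks_pos hi
  · simp only [Finset.mem_sigma, Finset.mem_filter, Finset.HasAntidiagonal.mem_antidiagonal] at hs
    rw [List.sum_cons, s.2.blocks_sum]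
    exact hs.1.1
  · intros; exact Finset.mem_univ _
  · rintro ⟨⟨a, b⟩, c⟩ h1 ⟨⟨a', b'⟩, c'⟩ h2 h
    simp only [Finset.mem_sigma, Finset.mem_filter,
      Finset.HasAntidiagonal.mem_antidiagonal] at h1 h2
    simp only [Composition.mk.injEq, List.cons.injEq] at h
    obtain ⟨rfl, h⟩ := h
    obtain rfl : b = b' := by omega
    obtain rfl : c = c' := Composition.ext h
    rfl
  · rintro ⟨l, hl, hs⟩ -
    rcases l with _ | ⟨a, l⟩
    · exact absurd hs.symm hn
    · refine ⟨⟨(a, l.sum), ⟨l, fun hi => hl (List.mem_cons_of_mem _ hi), rfl⟩⟩, ?_, rfl⟩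
      simp only [Finset.mem_sigma, Finset.mem_filter, Finset.HasAntidiagonal.mem_antidiagonal,
        Finset.mem_univ, and_true]
      exact ⟨by simpa using hs, (hl (List.mem_cons_self)).ne'⟩
  · intros; rfl

open PowerSeries in
/-- The solution of `X W' = G W` with `W(0) = 1`: iterating the recursion
`n W_n = ∑ p, G_p W_{n - p}` produces one term for each composition of `n`. -/
theorem coeff_eq_sum_composition {R : Type*} [Ring R] [Algebra ℂ R] {G W : PowerSeries R}
    (hG : coeff 0 G = 0) (hW : coeff 0 W = 1) (h : eulerDeriv W = G * W) (n : ℕ) :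
    coeff n W = ∑ c : Composition n,
      (lamWeight c.blocks : ℂ) • (c.blocks.map fun β => coeff β G).prod := by
  induction n using Nat.strong_induction_on with
  | _ n ih =>
    rcases eq_or_ne n 0 with rfl | hn
    · rw [Fintype.sum_eq_single (default : Composition 0) fun c hc =>
        (hc (Composition.ext ?_)).elim]
      swap
      · rw [c.blocks_eq_nil.2 rfl, (default : Composition 0).blocks_eq_nil.2 rfl]
      have : (default : Composition 0).blocks = [] :=
        (Composition.blocks_eq_nil _).2 rfl
      simp [this, lamWeight, hW]
    · have hn' : (n : ℂ) ≠ 0 := by exact_mod_cast hn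
      have h1 := congrArg (coeff n) h
      rw [coeff_eulerDeriv, coeff_mul, ← Nat.cast_smul_eq_nsmul ℂ] at h1
      rw [sum_composition_eq_sum_antidiagonal
        (fun l => (lamWeight l : ℂ) • (l.map fun β => coeff β G).prod) hn,
        ← inv_smul_smul₀ hn' (coeff n W), h1, Finset.smul_sum, Finset.sum_filter]
      refine Finset.sum_congr rfl fun p hp => ?_
      rw [Finset.HasAntidiagonal.mem_antidiagonal] at hp
      split_ifs with h0
      · rw [ih p.2 (by omega), Finset.mul_sum, Finset.smul_sum]
        refine Finset.sum_congr rfl fun c _ => ?_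
        rw [lamWeight, c.blocks_sum, hp, List.map_cons, List.prod_cons, mul_smul_comm, smul_smul]
        push_cast
        rfl
      · rw [not_not.1 h0, hG, zero_mul, smul_zero]

end Compositions

/-! ### Coefficients of nested commutators and the generator of the error -/

section CommutatorCoefficients

open Finset Nat

variable {N : ℕ}

/-- Coefficients of `[h_j, Y]` in terms of the coefficients `κ` of the nested commutators in `Y`:
the letter `j` is put in front of every word. Words of length at most one get the coefficient
zero, since the empty word stands for the commutator `0`, whereas the word `j` stands for `h_j`. -/
def adCoeff (j : Fin N) (κ : (β : ℕ) → (Fin β → Fin N) → ℝ) : (β : ℕ) → (Fin β → Fin N) → ℝ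
  | 0, _ => 0
  | 1, _ => 0
  | β + 2, w => if w 0 = j then κ (β + 1) (Fin.tail w) else 0

/-- The coefficients that are equal to `f j` on each one-letter word `j` and zero on all other
words. -/
def letterCoeff (f : Fin N → ℝ) : (β : ℕ) → (Fin β → Fin N) → ℝ
  | 1, w => f (w 0)
  | _, _ => 0

/-- For the stages `S` with product `V(z) = ∏ exp (z c h_j)`, the coefficients of the nested
commutators in `(z V'(z) - V(z) z H) V(z)⁻¹`. Adding a stage `(j, c)` on the left applies
`exp (z c ad h_j)` and adds `z c h_j`. -/
def generatorCoeff : ProductFormula N → (β : ℕ) → (Fin β → Fin N) → ℝ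
  | [] => letterCoeff fun _ => -1
  | s :: S => fun β w => letterCoeff (Pi.single s.1 s.2) β w +
      ∑ p ∈ range (β + 1), (s.2 ^ p / (p ! : ℝ)) * ((adCoeff s.1)^[p] (generatorCoeff S)) β w

variable {E : Type*} [NormedAddCommGroup E] [InnerProductSpace ℂ E]
  (h : Fin N → (E →L[ℂ] E))

@[simp]
theorem commutatorSum_zero (κ : (β : ℕ) → (Fin β → Fin N) → ℝ) : commutatorSum h κ 0 = 0 := by
  simp [commutatorSum, nestedCommutator]

theorem nestedCommutator_cons (j : Fin N) {w : List (Fin N)} (hw : w ≠ []) :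
    nestedCommutator h (j :: w) = innerDer (h j) (nestedCommutator h w) := by
  rcases w with _ | ⟨i, w⟩
  · exact absurd rfl hw
  · rfl

/-- For `β = 0` both sides vanish because the nested commutator of the empty word is `0`. -/
theorem commutatorSum_adCoeff (j : Fin N) (κ : (β : ℕ) → (Fin β → Fin N) → ℝ) (β : ℕ) :
    commutatorSum h (adCoeff j κ) (β + 1) = innerDer (h j) (commutatorSum h κ β) := by
  rcases β with _ | β
  · simp [commutatorSum, adCoeff, nestedCommutator]
  · rw [commutatorSum, commutatorSum, map_sum, ← (Fin.consEquiv fun _ => Fin N).sum_comp,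
      Fintype.sum_prod_type]
    rw [Fintype.sum_eq_single j]
    · refine Finset.sum_congr rfl fun w _ => ?_
      simp [adCoeff, Fin.consEquiv, nestedCommutator_cons]
    · intro i hi
      refine Finset.sum_eq_zero fun w _ => ?_
      simp [adCoeff, Fin.consEquiv, hi]

theorem commutatorSum_iterate_adCoeff (j : Fin N) (p : ℕ) (κ : (β : ℕ) → (Fin β → Fin N) → ℝ)
    (q : ℕ) :
    commutatorSum h ((adCoeff j)^[p] κ) (p + q) =
      (innerDer (h j) ^ p) (commutatorSum h κ q) := by
  induction p with
  | zero => simp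
  | succ p ih =>
    rw [Function.iterate_succ_apply', Nat.add_right_comm, commutatorSum_adCoeff, ih,
      _root_.pow_succ', Module.End.mul_apply]

theorem commutatorSum_letterCoeff (f : Fin N → ℝ) :
    commutatorSum h (letterCoeff f) 1 = ∑ j, (f j : ℂ) • h j := by
  rw [commutatorSum, ← (Equiv.funUnique (Fin 1) (Fin N)).symm.sum_comp]
  simp [letterCoeff, nestedCommutator]

theorem commutatorSum_letterCoeff_of_ne (f : Fin N → ℝ) {β : ℕ} (hβ : β ≠ 1) :
    commutatorSum h (letterCoeff f) β = 0 := by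
  rcases β with _ | _ | β
  · simp
  · exact absurd rfl hβ
  · simp [commutatorSum, letterCoeff]

open PowerSeries in
/-- The formal series of nested commutators with the coefficients of the stages `S`. -/
def generatorSeries (S : ProductFormula N) : PowerSeries (E →L[ℂ] E) :=
  PowerSeries.mk (commutatorSum h (generatorCoeff S))

theorem innerDer_smul_pow {R : Type*} [Ring R] [Algebra ℂ R] (c : ℂ) (A y : R) (p : ℕ) :
    (innerDer (c • A) ^ p) y = c ^ p • (innerDer A ^ p) y := by
  have : innerDer (c • A) = c • innerDer A := by
    ext y
    simp [smul_sub]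
  rw [this, smul_pow, LinearMap.smul_apply]

theorem mk_commutatorSum_letterCoeff (f : Fin N → ℝ) :
    PowerSeries.mk (commutatorSum h (letterCoeff f)) =
      PowerSeries.X * PowerSeries.C (∑ j, (f j : ℂ) • h j) := by
  ext1 n
  rcases n with _ | _ | n
  · simp
  · rw [PowerSeries.coeff_succ_X_mul]
    simp [commutatorSum_letterCoeff]
  · rw [PowerSeries.coeff_succ_X_mul]
    simp [commutatorSum_letterCoeff_of_ne]

theorem generatorSeries_nil :
    generatorSeries h [] = -(PowerSeries.X * PowerSeries.C (hamiltonian h)) := by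
  rw [generatorSeries, generatorCoeff, mk_commutatorSum_letterCoeff, ← mul_neg, ← map_neg]
  simp [hamiltonian]

/-- The recursion behind `generatorCoeff`: a new leftmost exponential `exp (z A)` conjugates the
generator by `exp (z A)` and contributes `z A`. -/
theorem generatorSeries_cons (s : Fin N × ℝ) (S : ProductFormula N) :
    generatorSeries h (s :: S) = PowerSeries.X * PowerSeries.C ((s.2 : ℂ) • h s.1) +
      formalConj ((s.2 : ℂ) • h s.1) (generatorSeries h S) := by
  have h1 : (s.2 : ℂ) • h s.1 = ∑ j, ((Pi.single s.1 s.2 : Fin N → ℝ) j : ℂ) • h j := by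
    rw [Fintype.sum_eq_single s.1]
    · simp
    · intro j hj
      simp [hj]
  rw [h1, ← mk_commutatorSum_letterCoeff, ← h1]
  ext1 n
  simp only [generatorSeries, map_add, PowerSeries.coeff_mk, formalConj, innerDer_smul_pow,
    ← commutatorSum_iterate_adCoeff]
  rw [Finset.Nat.sum_antidiagonal_eq_sum_range_succ_mk]
  have h2 : ∀ p ∈ range (n + 1), ((p ! : ℂ)⁻¹) • (s.2 : ℂ) ^ p •
      commutatorSum h ((adCoeff s.1)^[p] (generatorCoeff S)) (p + (n - p)) =
      ∑ w : Fin n → Fin N, ((((s.2 ^ p / (p ! : ℝ)) *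
        ((adCoeff s.1)^[p] (generatorCoeff S)) n w : ℝ)) : ℂ) •
          nestedCommutator h (List.ofFn w) := by
    intro p hp
    rw [Nat.add_sub_cancel' (Nat.lt_succ_iff.1 (Finset.mem_range.1 hp)), commutatorSum,
      smul_smul, Finset.smul_sum]
    refine Finset.sum_congr rfl fun w _ => ?_
    rw [smul_smul]
    congr 1
    push_cast
    ring
  rw [Finset.sum_congr rfl h2, Finset.sum_comm, commutatorSum, commutatorSum,
    ← Finset.sum_add_distrib]
  refine Finset.sum_congr rfl fun w _ => ?_
  rw [generatorCoeff, ← Finset.sum_smul, ← add_smul, Complex.ofReal_add, Complex.ofReal_sum]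

/-- The formal series of the product `∏ exp (z c h_j)` of the stages `(j, c)`. -/
def stageSeries (S : ProductFormula N) : PowerSeries (E →L[ℂ] E) :=
  (S.map fun s => formalExp ((s.2 : ℂ) • h s.1)).prod

/-- The defining equation of the generator, with `V⁻¹` cleared: `z V' = C V + V z H`. -/
theorem eulerDeriv_stageSeries (S : ProductFormula N) :
    eulerDeriv (stageSeries h S) = generatorSeries h S * stageSeries h S +
      stageSeries h S * (PowerSeries.X * PowerSeries.C (hamiltonian h)) := by
  induction S with
  | nil => simp [stageSeries, generatorSeries_nil]
  | cons s S ih =>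
    have h1 : stageSeries h (s :: S) = formalExp ((s.2 : ℂ) • h s.1) * stageSeries h S := rfl
    rw [h1, eulerDeriv_mul, ih, generatorSeries_cons, add_mul, ← mul_assoc (formalConj _ _),
      formalConj_mul_formalExp, formalExp_eulerDeriv]
    noncomm_ring

/-- The formal series of the error operator `V(z) exp (-z H)`. -/
def errorSeries (S : ProductFormula N) : PowerSeries (E →L[ℂ] E) :=
  stageSeries h S * formalExp (-hamiltonian h)

theorem eulerDeriv_errorSeries (S : ProductFormula N) :
    eulerDeriv (errorSeries h S) = generatorSeries h S * errorSeries h S := by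
  rw [errorSeries, eulerDeriv_mul, eulerDeriv_stageSeries, formalExp_eulerDeriv, map_neg]
  noncomm_ring

theorem coeff_zero_errorSeries (S : ProductFormula N) :
    PowerSeries.coeff 0 (errorSeries h S) = 1 := by
  have h1 : ∀ A : E →L[ℂ] E, PowerSeries.constantCoeff (formalExp A) = 1 := fun A => by
    rw [← PowerSeries.coeff_zero_eq_constantCoeff_apply]
    simp
  rw [PowerSeries.coeff_zero_eq_constantCoeff_apply, errorSeries, map_mul, h1, mul_one,
    stageSeries, map_list_prod, List.map_map]
  refine List.prod_eq_one fun x hx => ?_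
  obtain ⟨s, -, rfl⟩ := List.mem_map.1 hx
  exact h1 _

theorem coeff_errorSeries (S : ProductFormula N) (n : ℕ) :
    PowerSeries.coeff n (errorSeries h S) = ∑ c : Composition n,
      (lamWeight c.blocks : ℂ) • (c.blocks.map (commutatorSum h (generatorCoeff S))).prod := by
  rw [coeff_eq_sum_composition (G := generatorSeries h S) (by simp [generatorSeries])
    (coeff_zero_errorSeries h S) (eulerDeriv_errorSeries h S)]
  simp [generatorSeries]

/-- The recursion `n W_n = ∑ p, C_p W_{n - p}` determines the `C_β` from the `W_n`. -/
theorem commutatorSum_eq_zero_of_coeff_errorSeries (S : ProductFormula N) (α : ℕ)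
    (hW : ∀ n, n ≠ 0 → n ≤ α → PowerSeries.coeff n (errorSeries h S) = 0) (β : ℕ) (hβ : β ≤ α) :
    commutatorSum h (generatorCoeff S) β = 0 := by
  rcases eq_or_ne β 0 with rfl | h0
  · simp
  · have h1 := congrArg (PowerSeries.coeff β) (eulerDeriv_errorSeries h S)
    rw [coeff_eulerDeriv, hW β h0 hβ, smul_zero, PowerSeries.coeff_mul,
      Finset.sum_eq_single (β, 0)] at h1
    -- Only the term `C_β W_0 = C_β` of the recursion is left.
    · simpa [coeff_zero_errorSeries, generatorSeries] using h1.symm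
    · rintro ⟨p, q⟩ hpq hne
      rw [Finset.HasAntidiagonal.mem_antidiagonal] at hpq
      dsimp only at hpq ⊢
      rw [hW q (by rintro rfl; exact hne (by rw [← hpq, add_zero])) (by omega), mul_zero]
    · intro hn
      exact absurd (Finset.HasAntidiagonal.mem_antidiagonal.2 (add_zero β)) hn

end CommutatorCoefficients

/-! ### Convergence and extraction of coefficients -/

section Evaluation

open PowerSeries

variable {R : Type*} [NormedRing R] [NormedAlgebra ℂ R]

/-- The formal power series `f` converges absolutely at `z`, with sum `x`. -/
def HasAbsSum (f : PowerSeries R) (z : ℂ) (x : R) : Prop :=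
  (Summable fun n => ‖z ^ n • coeff n f‖) ∧ HasSum (fun n => z ^ n • coeff n f) x

theorem HasAbsSum.one (z : ℂ) : HasAbsSum (1 : PowerSeries R) z 1 := by
  have h : ∀ n ≠ 0, z ^ n • coeff n (1 : PowerSeries R) = 0 := fun n hn => by
    simp [coeff_one, hn]
  refine ⟨summable_of_ne_finset_zero (s := {0}) fun n hn => ?_, ?_⟩
  · rw [h n (by simpa using hn), norm_zero]
  · simpa using hasSum_single 0 h

theorem HasAbsSum.mul [CompleteSpace R] {f g : PowerSeries R} {z : ℂ} {x y : R}
    (hf : HasAbsSum f z x) (hg : HasAbsSum g z y) : HasAbsSum (f * g) z (x * y) := by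
  have h : ∀ n, z ^ n • coeff n (f * g) = ∑ p ∈ Finset.HasAntidiagonal.antidiagonal n,
      (z ^ p.1 • coeff p.1 f) * (z ^ p.2 • coeff p.2 g) := fun n => by
    rw [coeff_mul, Finset.smul_sum]
    refine Finset.sum_congr rfl fun p hp => ?_
    rw [← Finset.HasAntidiagonal.mem_antidiagonal.1 hp, smul_mul_smul_comm, pow_add]
  have hs := summable_norm_sum_mul_antidiagonal_of_summable_norm hf.1 hg.1
  simp only [HasAbsSum, h]
  refine ⟨hs, ?_⟩
  have := tsum_mul_tsum_eq_tsum_sum_antidiagonal_of_summable_norm hf.1 hg.1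
  rw [hf.2.tsum_eq, hg.2.tsum_eq] at this
  rw [this]
  exact hs.of_norm.hasSum

theorem HasAbsSum.list_prod [CompleteSpace R] {ι : Type*} (l : List ι) {f : ι → PowerSeries R}
    {z : ℂ} {x : ι → R} (h : ∀ i, HasAbsSum (f i) z (x i)) :
    HasAbsSum (l.map f).prod z (l.map x).prod := by
  induction l with
  | nil => exact HasAbsSum.one z
  | cons i l ih => exact (h i).mul ih

theorem hasAbsSum_formalExp [CompleteSpace R] (A : R) (z : ℂ) :
    HasAbsSum (formalExp A) z (NormedSpace.exp (z • A)) := by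
  have h : ∀ n, z ^ n • coeff n (formalExp A) = ((n.factorial : ℂ)⁻¹) • (z • A) ^ n := fun n => by
    rw [coeff_formalExp, smul_pow, smul_comm]
  simp only [HasAbsSum, h]
  exact ⟨NormedSpace.norm_expSeries_summable' _, NormedSpace.exp_series_hasSum_exp' _⟩

/-- Coefficient extraction: a function that is `O(t ^ (p + 1))` has no Taylor coefficient of order
at most `p`. -/
theorem coeff_eq_zero_of_isBigO {F : Type*} [NormedAddCommGroup F] [NormedSpace ℝ F] {f : ℝ → F}
    {a : ℕ → F} (hf : ∀ t, HasSum (fun n => t ^ n • a n) (f t)) {p : ℕ}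
    (hO : f =O[𝓝 0] fun t => t ^ (p + 1)) (n : ℕ) (hn : n ≤ p) : a n = 0 := by
  let q : FormalMultilinearSeries ℝ ℝ F := fun n =>
    ContinuousMultilinearMap.mkPiRing ℝ (Fin n) (a n)
  have hq : ∀ n, q.coeff n = a n := fun n => by simp [q, FormalMultilinearSeries.coeff]
  have hfq : HasFPowerSeriesAt f q 0 := by
    rw [hasFPowerSeriesAt_iff]
    exact Filter.Eventually.of_forall fun t => by simpa [hq] using hf t
  induction n using Nat.strong_induction_on with
  | _ n ih =>
    have h1 := hfq.isBigO_sub_partialSum_pow (n + 1)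
    have h2 : ∀ y : ℝ, q.partialSum (n + 1) y = q n fun _ => y := fun y => by
      rw [FormalMultilinearSeries.partialSum, Finset.sum_range_succ, Finset.sum_eq_zero, zero_add]
      intro i hi
      have hi' := Finset.mem_range.1 hi
      simp [q, ih i hi' (by omega)]
    have h3 : f =O[𝓝 0] fun t : ℝ => ‖t‖ ^ (n + 1) := by
      refine hO.trans (Asymptotics.IsBigO.of_bound 1 ?_)
      filter_upwards [Metric.ball_mem_nhds (0 : ℝ) one_pos] with t ht
      rw [one_mul, norm_pow, norm_pow, norm_norm]
      exact pow_le_pow_of_le_one (norm_nonneg t) (mem_ball_zero_iff.1 ht).le (Nat.succ_le_succ hn)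
    have h4 : (fun y : ℝ => q n fun _ => y) =O[𝓝 0] fun t : ℝ => ‖t‖ ^ (n + 1) := by
      have := h3.sub h1
      simpa [h2] using this
    have h5 := h4.continuousMultilinearMap_apply_eq_zero 1
    simpa [q] using h5

end Evaluation

/-! ### Evolutions and order conditions -/

section Operators

variable {N : ℕ} {E : Type*} [NormedAddCommGroup E] [InnerProductSpace ℂ E] [CompleteSpace E]

theorem evolution_zero (A : E →L[ℂ] E) : evolution A 0 = 1 := by
  simp [evolution, NormedSpace.exp_zero]

theorem evolution_add (A : E →L[ℂ] E) (s t : ℝ) :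
    evolution A (s + t) = evolution A s * evolution A t := by
  let _ : NormedAlgebra ℚ (E →L[ℂ] E) := NormedAlgebra.restrictScalars ℚ ℂ (E →L[ℂ] E)
  rw [evolution, evolution, evolution, ← NormedSpace.exp_add_of_commute, ← add_smul]
  · push_cast
    ring_nf
  · exact ((Commute.refl A).smul_left _).smul_right _

theorem evolution_div_pow (A : E →L[ℂ] E) {k : ℕ} (hk : 0 < k) (t : ℝ) :
    evolution A (t / k) ^ k = evolution A t := by
  have h : ∀ n : ℕ, ∀ s : ℝ, evolution A s ^ n = evolution A (n * s) := fun n s => by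
    induction n with
    | zero => simp [evolution_zero]
    | succ n ih => rw [pow_succ, ih, ← evolution_add]; push_cast; ring_nf
  rw [h, mul_div_cancel₀]
  exact_mod_cast hk.ne'

theorem continuous_evolution (A : E →L[ℂ] E) : Continuous (evolution A) := by
  let _ : NormedAlgebra ℚ (E →L[ℂ] E) := NormedAlgebra.restrictScalars ℚ ℂ (E →L[ℂ] E)
  exact NormedSpace.exp_continuous.comp (by fun_prop)

theorem continuous_toOp (P : ProductFormula N) (h : Fin N → (E →L[ℂ] E)) :
    Continuous (P.toOp h) :=
  continuous_list_prod P fun s _ =>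
    (continuous_evolution (h s.1)).comp (continuous_const.mul continuous_id)

/-- The stages of the `k`-fold repetition `U(Δ / k) ^ k` of a product formula, as a product
formula in `Δ`. -/
def ProductFormula.repeated (P : ProductFormula N) (k : ℕ) : ProductFormula N :=
  (List.replicate k (P.map fun s => (s.1, s.2 / (k : ℝ)))).flatten

theorem ProductFormula.toOp_repeated (P : ProductFormula N) (h : Fin N → (E →L[ℂ] E)) (k : ℕ)
    (t : ℝ) : (P.repeated k).toOp h t = P.toOp h (t / k) ^ k := by
  simp [ProductFormula.toOp, ProductFormula.repeated, List.map_flatten, List.prod_flatten,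
    Function.comp_def, div_mul_eq_mul_div, mul_div_assoc]

theorem hasAbsSum_errorSeries (S : ProductFormula N) (h : Fin N → (E →L[ℂ] E)) (t : ℝ) :
    HasAbsSum (errorSeries h S) (-Complex.I * t)
      (S.toOp h t * evolution (hamiltonian h) (-t)) := by
  refine HasAbsSum.mul (HasAbsSum.list_prod S fun s => ?_) ?_
  · have h1 : (-Complex.I * ((s.2 * t : ℝ) : ℂ)) • h s.1 =
        (-Complex.I * (t : ℂ)) • (s.2 : ℂ) • h s.1 := by
      rw [smul_smul]
      push_cast
      ring_nf
    rw [evolution, h1]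
    exact hasAbsSum_formalExp _ _
  · have h1 : (-Complex.I * ((-t : ℝ) : ℂ)) • hamiltonian h =
        (-Complex.I * (t : ℂ)) • (-hamiltonian h) := by
      push_cast
      rw [mul_neg, neg_smul, smul_neg]
    rw [evolution, h1]
    exact hasAbsSum_formalExp _ _

/-- Telescoping: powers of two locally bounded functions are as close as the functions. -/
theorem isBigO_pow_sub_pow {R : Type*} [NormedRing R] {X Y : ℝ → R} {g : ℝ → ℝ}
    (hX : ContinuousAt X 0) (hY : ContinuousAt Y 0)
    (h : (fun t => X t - Y t) =O[𝓝 0] g) (k : ℕ) :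
    (fun t => X t ^ k - Y t ^ k) =O[𝓝 0] g := by
  induction k with
  | zero => simpa using Asymptotics.isBigO_zero g (𝓝 0)
  | succ k ih =>
    have h1 : (fun t => X t ^ k) =O[𝓝 0] fun _ => (1 : ℝ) :=
      (hX.pow k).isBigO_one ℝ
    have h2 : Y =O[𝓝 0] fun _ => (1 : ℝ) := hY.isBigO_one ℝ
    have h3 := h1.mul h
    have h4 := ih.mul h2
    simp only [one_mul, mul_one] at h3 h4
    refine (h3.add h4).congr_left fun t => ?_
    rw [pow_succ, pow_succ]
    noncomm_ring

theorem CorrectToOrder.isBigO_mul_evolution_sub_one {V : ℝ → (E →L[ℂ] E)} {H : E →L[ℂ] E} {p : ℕ}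
    (hV : CorrectToOrder V H p) :
    (fun t => V t * evolution H (-t) - 1) =O[𝓝 0] fun t : ℝ => t ^ (p + 1) := by
  have h1 : (fun t : ℝ => evolution H (-t)) =O[𝓝 0] fun _ => (1 : ℝ) :=
    ((continuous_evolution H).comp continuous_neg).continuousAt.isBigO_one ℝ
  have h2 := Asymptotics.IsBigO.mul hV h1
  simp only [mul_one] at h2
  refine h2.congr_left fun t => ?_
  rw [sub_mul, ← evolution_add, add_neg_cancel, evolution_zero]

theorem CorrectToOrder.repeated {P : ProductFormula N} {h : Fin N → (E →L[ℂ] E)} {p : ℕ}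
    (hP : CorrectToOrder (P.toOp h) (hamiltonian h) p) {k : ℕ} (hk : 0 < k) :
    CorrectToOrder ((P.repeated k).toOp h) (hamiltonian h) p := by
  have hc : Continuous fun t : ℝ => t / k := by fun_prop
  have ht : Filter.Tendsto (fun t : ℝ => t / k) (𝓝 0) (𝓝 0) := by
    simpa using hc.tendsto 0
  have h1 : (fun t : ℝ => P.toOp h (t / k) - evolution (hamiltonian h) (t / k)) =O[𝓝 0]
      fun t : ℝ => t ^ (p + 1) := by
    refine (Asymptotics.IsBigO.comp_tendsto hP ht).trans ?_
    simp only [Function.comp_def, div_eq_mul_inv]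
    simp only [mul_comm _ (((k : ℝ)⁻¹) ^ (p + 1)), mul_pow]
    exact Asymptotics.isBigO_const_mul_self _ _ _
  have h2 := isBigO_pow_sub_pow ((continuous_toOp P h).comp hc).continuousAt
    ((continuous_evolution _).comp hc).continuousAt h1 k
  refine h2.congr_left fun t => ?_
  simp only [Function.comp_apply, evolution_div_pow _ hk, ProductFormula.toOp_repeated]

/-- Subtracting the identity from the sum changes the coefficient of order zero only. -/
theorem HasSum.sub_one_of_pow_smul {R : Type*} [NormedRing R] [NormedAlgebra ℂ R] {a : ℕ → R}
    {z : ℂ} {x : R} (hx : HasSum (fun n => z ^ n • a n) x) :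
    HasSum (fun n => z ^ n • (a n - if n = 0 then 1 else 0)) (x - 1) := by
  refine (hx.sub (hasSum_ite_eq 0 (1 : R))).congr_fun fun n => ?_
  rcases eq_or_ne n 0 with rfl | hn
  · simp
  · simp [hn]

/-- If an expansion in powers of `-i t` is `1 + O(t ^ (p + 1))`, its coefficients of order at most
`p` are those of the constant `1`. -/
theorem coeff_eq_ite_of_isBigO_sub_one {R : Type*} [NormedRing R] [NormedAlgebra ℂ R] {a : ℕ → R}
    {f : ℝ → R} (hf : ∀ t : ℝ, HasSum (fun n => (-Complex.I * (t : ℂ)) ^ n • a n) (f t)) {p : ℕ}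
    (hO : (fun t => f t - 1) =O[𝓝 0] fun t : ℝ => t ^ (p + 1)) (n : ℕ) (hn : n ≤ p) :
    a n = if n = 0 then 1 else 0 := by
  let _ : NormedSpace ℝ R := NormedSpace.restrictScalars ℝ ℂ R
  have h1 : ∀ t : ℝ, HasSum (fun n => t ^ n • ((-Complex.I) ^ n • (a n - if n = 0 then 1 else 0)))
      (f t - 1) := fun t => by
    refine (hf t).sub_one_of_pow_smul.congr_fun fun n => ?_
    rw [mul_pow, mul_comm, mul_smul, ← Complex.ofReal_pow]
    rfl
  have h2 := coeff_eq_zero_of_isBigO h1 hO n hn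
  rw [smul_eq_zero_iff_right (pow_ne_zero _ (neg_ne_zero.2 Complex.I_ne_zero))] at h2
  exact sub_eq_zero.1 h2

end Operators

end

theorem theorem3 {N : ℕ} (P : ProductFormula N) :
    ∃ κ : ℕ → (β : ℕ) → (Fin β → Fin N) → ℝ,
      ∀ (E : Type*) [NormedAddCommGroup E] [InnerProductSpace ℂ E] [CompleteSpace E]
        (h : Fin N → (E →L[ℂ] E)) (_hsa : ∀ j, IsSelfAdjoint (h j))
        (α m M : ℕ) (a : Fin M → ℝ) (k : Fin M → ℕ) (_hk : ∀ j, 0 < k j)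
        (_hbase : CorrectToOrder (P.toOp h) (hamiltonian h) α)
        (_hmulti : CorrectToOrder (multiproduct P a k h) (hamiltonian h) (2 * m))
        (Δ : ℝ),
        HasSum
          (fun n : {n : ℕ // 2 * m < n} =>
            (-Complex.I * (Δ : ℂ)) ^ (n : ℕ) •
              ∑ c : Composition (n : ℕ) with ∀ β ∈ c.blocks, α < β,
                (lamWeight c.blocks : ℂ) •
                  ∑ j, (a j : ℂ) • (c.blocks.map (commutatorSum h (κ (k j)))).prod)
          (multiproduct P a k h Δ * evolution (hamiltonian h) (-Δ) - 1) := by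
  refine ⟨fun k => generatorCoeff (P.repeated k), ?_⟩
  intro E _ _ _ h _ α m M a k hk hbase hmulti Δ
  set W : ℕ → (E →L[ℂ] E) := fun n =>
    ∑ j, (a j : ℂ) • PowerSeries.coeff n (errorSeries h (P.repeated (k j))) with hW
  have hsum : ∀ t : ℝ, HasSum (fun n => (-Complex.I * (t : ℂ)) ^ n • W n)
      (multiproduct P a k h t * evolution (hamiltonian h) (-t)) := fun t => by
    simp only [hW, multiproduct, Finset.sum_mul, Finset.smul_sum]
    refine hasSum_sum fun j _ => ?_
    rw [← ProductFormula.toOp_repeated, smul_mul_assoc]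
    simp only [smul_comm _ (a j : ℂ)]
    exact (hasAbsSum_errorSeries (P.repeated (k j)) h t).2.const_smul _
  have hlow : ∀ n ≤ 2 * m, W n = if n = 0 then 1 else 0 :=
    coeff_eq_ite_of_isBigO_sub_one hsum hmulti.isBigO_mul_evolution_sub_one
  have hcomm : ∀ j, ∀ β ≤ α, commutatorSum h (generatorCoeff (P.repeated (k j))) β = 0 :=
    fun j => commutatorSum_eq_zero_of_coeff_errorSeries h _ α fun n hn0 hn => by
      rw [coeff_eq_ite_of_isBigO_sub_one
        (fun t => (hasAbsSum_errorSeries (P.repeated (k j)) h t).2)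
        (hbase.repeated (hk j)).isBigO_mul_evolution_sub_one n hn, if_neg hn0]
  have hterm : ∀ n, ∑ c : Composition n with ∀ β ∈ c.blocks, α < β,
      (lamWeight c.blocks : ℂ) • ∑ j, (a j : ℂ) •
        (c.blocks.map (commutatorSum h (generatorCoeff (P.repeated (k j))))).prod = W n := by
    intro n
    simp only [hW, coeff_errorSeries, Finset.smul_sum]
    rw [Finset.sum_comm (s := Finset.univ) (t := (Finset.univ : Finset (Composition n))),
      Finset.sum_filter_of_ne]
    · refine Finset.sum_congr rfl fun c _ => Finset.sum_congr rfl fun j _ => ?_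
      rw [smul_comm]
    -- A composition with a block `β ≤ α` contributes zero, since its factor `C_β` vanishes.
    · intro c _ hne β hβ
      by_contra hlt
      refine hne (Finset.sum_eq_zero fun j _ => ?_)
      rw [List.prod_eq_zero (List.mem_map.2 ⟨β, hβ, hcomm j β (not_lt.1 hlt)⟩), smul_zero,
        smul_zero]
  simp only [hterm]
  have hsupp : Function.support (fun n => (-Complex.I * (Δ : ℂ)) ^ n •
      (W n - if n = 0 then 1 else 0)) ⊆ {n | 2 * m < n} := fun n hn => by
    by_contra hle
    exact hn (by simp only [hlow n (not_lt.1 hle), sub_self, smul_zero])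
  refine ((hasSum_subtype_iff_of_support_subset hsupp).2
    (hsum Δ).sub_one_of_pow_smul).congr_fun fun n => ?_
  have hn : (n : ℕ) ≠ 0 := (Nat.zero_le _).trans_lt n.2 |>.ne'
  simp only [Function.comp_apply, if_neg hn, sub_zero]
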